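/- A function with rational values is computable if numerators and denominators of its values can be computed. A lower semicomputable semimeasure on $\mathbb{N}$ is a function $\mu\colon\mathbb{N}\to[0,\infty)$ with $\sum_i\mu(i)\le 1$ for which there is a computable function $q\colon\mathbb{N}\times\mathbb{N}\to\mathbb{Q}$ such that, for every $i$, the sequence $q(i,s)$ is nondecreasing in $s$ and converges to $\mu(i)$. Such a $\mu$ is universal (and $\mu(i)$ is then called the a priori probability of $i$) if for every lower semicomputable semimeasure $\nu$ there is a constant $C>0$ with $\nu(i)\le C\,\mu(i)$ for all $i$. A real $\alpha$ is Martin-Löf random if there are no computable $l,r\colon\mathbb{N}\times\mathbb{N}\to\mathbb{Q}$ such that for every $n$ the open set $U_n=\bigcup_k (l(n,k),r(n,k))$ has Lebesgue measure at most $2^{-n}$ and contains $\alpha$. **Theorem.** Let $\mu$ be a universal semimeasure on $\mathbb{N}$, and for $k\in\mathbb{Z}$ let $BP'(k)$ be the least $N\in\mathbb{N}$ such that $\sum_{n>N}\mu(n)<2^{-k}$. Let $(a_i)_{i\in\mathbb{N}}$ be a computable increasing (that is, nondecreasing) sequence of rational numbers that converges to a Martin-Löf random real $\alpha$, and for $\varepsilon>0$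 let $N(\varepsilon)$ be the least $N\in\mathbb{N}$ such that $|\alpha-a_n|<\varepsilon$ for all $n>N$. Then there is a constant $c\in\mathbb{N}$ such that $$N(2^{-m})\ \ge\ BP'(m-c)\qquad\text{for all } m\in\mathbb{N}.$$ -/

import Mathlib

open Filter Topology MeasureTheory

noncomputable section

namespace CompetingBeavers

/-- A rational-valued function is computable if it can be written as `(p - q) / (d + 1)` with
computable natural-number-valued functions `p`, `q`, `d`. -/
def ComputableRat {β : Type*} [Primcodable β] (f : β → ℚ) : Prop :=
  ∃ p q d : β → ℕ, Computable p ∧ Computable q ∧ Computable d ∧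
    ∀ x, f x = ((p x : ℚ) - (q x : ℚ)) / ((d x : ℚ) + 1)

/-- The effectively open subset of the line that is the union of the rational intervals
`(l (n, k), r (n, k))`, `k = 0, 1, 2, …` (an interval with `r ≤ l` is empty). -/
def openSection (l r : ℕ × ℕ → ℚ) (n : ℕ) : Set ℝ :=
  ⋃ k : ℕ, Set.Ioo (l (n, k) : ℝ) (r (n, k) : ℝ)

/-- A Martin-Löf test: a uniformly effectively open sequence of subsets of the line, the `n`-th of
Lebesgue measure at most `2 ^ (-n)`. -/
def IsMartinLofTest (l r : ℕ × ℕ → ℚ) : Prop :=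
  ComputableRat l ∧ ComputableRat r ∧
    ∀ n, volume (openSection l r n) ≤ (2⁻¹ : ENNReal) ^ n

/-- A real number is Martin-Löf random if no Martin-Löf test covers it at all levels. -/
def IsMartinLofRandom (α : ℝ) : Prop :=
  ∀ l r : ℕ × ℕ → ℚ, IsMartinLofTest l r → ∃ n, α ∉ openSection l r n

/-- `μ i` is, uniformly in `i`, the limit of a computable nondecreasing sequence of rationals. -/
def LowerSemicomputable (μ : ℕ → ℝ) : Prop :=
  ∃ q : ℕ × ℕ → ℚ, ComputableRat q ∧
    ∀ i, Monotone (fun s => q (i, s)) ∧ Tendsto (fun s => (q (i, s) : ℝ)) atTop (𝓝 (μ i))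

/-- Lower semicomputable semimeasures on the natural numbers. -/
structure IsLSCSemimeasure (μ : ℕ → ℝ) : Prop where
  nonneg : ∀ i, 0 ≤ μ i
  summable : Summable μ
  tsum_le_one : ∑' i, μ i ≤ 1
  lowerSemicomputable : LowerSemicomputable μ

/-- Universal semimeasures (a priori probabilities on the natural numbers): lower semicomputable
semimeasures that are maximal up to a constant factor. -/
structure IsUniversalSemimeasure (μ : ℕ → ℝ) : Prop extends IsLSCSemimeasure μ where
  maximal : ∀ ν : ℕ → ℝ, IsLSCSemimeasure ν → ∃ C : ℝ, 0 < C ∧ ∀ i, ν i ≤ C * μ i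

/-- The modulus of convergence: the least `N` such that `|α - a n| < ε` for all `n > N`. -/
def modulus (a : ℕ → ℚ) (α ε : ℝ) : ℕ :=
  sInf {N : ℕ | ∀ n, N < n → |α - (a n : ℝ)| < ε}

/-- `BP' μ k` is the least `N` such that the total `μ`-probability of all `n > N` is less than
`2 ^ (-k)`. -/
def BP' (μ : ℕ → ℝ) (k : ℤ) : ℕ :=
  sInf {N : ℕ | ∑' n : Set.Ioi N, μ n < (2 : ℝ) ^ (-k)}

/-- The minimum in the definition of `modulus` is attained. -/
theorem modulus_spec {a : ℕ → ℚ} {α ε : ℝ}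
    (h : Tendsto (fun i => (a i : ℝ)) atTop (𝓝 α)) (hε : 0 < ε) :
    ∀ n, modulus a α ε < n → |α - (a n : ℝ)| < ε := by
  have hne : {N : ℕ | ∀ n, N < n → |α - (a n : ℝ)| < ε}.Nonempty := by
    obtain ⟨N, hN⟩ := Metric.tendsto_atTop.1 h ε hε
    refine ⟨N, fun n hn => ?_⟩
    have := hN n hn.le
    rwa [Real.dist_eq, abs_sub_comm] at this
  exact Nat.sInf_mem hne

/-- The minimum in the definition of `BP'` is attained. -/
theorem BP'_spec (μ : ℕ → ℝ) (k : ℤ) :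
    ∑' n : Set.Ioi (BP' μ k), μ n < (2 : ℝ) ^ (-k) := by
  have hne : {N : ℕ | ∑' n : Set.Ioi N, μ n < (2 : ℝ) ^ (-k)}.Nonempty := by
    have h0 : Tendsto (fun N : ℕ => ∑' n : Set.Ioi N, μ n) atTop (𝓝 0) := by
      have h1 := (tendsto_sum_nat_add μ).comp (tendsto_add_atTop_nat 1)
      refine h1.congr fun N => ?_
      let e : ℕ ≃ Set.Ioi N :=
        { toFun := fun j => ⟨j + (N + 1), by simp only [Set.mem_Ioi]; omega⟩
          invFun := fun n => n.1 - (N + 1)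
          left_inv := fun j => by simp
          right_inv := fun n => by
            have := n.2
            simp only [Set.mem_Ioi] at this
            ext; simp only; omega }
      exact e.tsum_eq (fun n : Set.Ioi N => μ n)
    obtain ⟨N, hN⟩ := (h0.eventually_lt_const (by positivity : (0 : ℝ) < 2 ^ (-k))).exists
    exact ⟨N, hN⟩
  exact Nat.sInf_mem hne

end CompetingBeavers

end

open Filter Topology MeasureTheory

namespace CompetingBeavers

/-! ### Arithmetic of computable rational-valued functions. -/

section ComputableRat

variable {β γ : Type*} [Primcodable β] [Primcodable γ]

/-! Put `b t = ∑ i < t, max (q (i, t)) 0`, where `q` approximates `μ` from below (`exists_approx`).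
The tail of `μ` beyond `N` is at most the remaining growth of `b` after step `N + 1`. Randomness of
`α` gives `b t - b s ≤ 2 ^ n * (α - a s)` for some `n` and all `s ≤ t` (`exists_mul_sub_le`); taking
`s = N + 1` with `N` the modulus bounds that growth. If the inequality fails at level `n`, then `α`
lies between `a t` and `a s + 2⁻¹ ^ n * (b t - b s)` for some `s ≤ t`. These intervals form a
Martin-Löf test: a queueing argument (`volume_iUnion_Ioo_le`) bounds their union by the total work
`2⁻¹ ^ n`. -/

theorem ComputableRat.comp {f : β → ℚ} (hf : ComputableRat f) {g : γ → β} (hg : Computable g) :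
    ComputableRat fun x => f (g x) := by
  obtain ⟨p, q, d, hp, hq, hd, h⟩ := hf
  exact ⟨_, _, _, hp.comp hg, hq.comp hg, hd.comp hg, fun x => h (g x)⟩

theorem computable_nat_add {f g : β → ℕ} (hf : Computable f) (hg : Computable g) :
    Computable fun x => f x + g x :=
  Primrec.nat_add.to_comp.comp hf hg

theorem computable_nat_mul {f g : β → ℕ} (hf : Computable f) (hg : Computable g) :
    Computable fun x => f x * g x :=
  Primrec.nat_mul.to_comp.comp hf hg

theorem computable_nat_sub {f g : β → ℕ} (hf : Computable f) (hg : Computable g) :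
    Computable fun x => f x - g x :=
  Primrec.nat_sub.to_comp.comp hf hg

theorem computable_two_pow : Computable fun n : ℕ => 2 ^ n := by
  have h : Computable fun n : ℕ => Nat.rec (motive := fun _ => ℕ) 1 (fun _ y => y * 2) n :=
    Computable.nat_rec (h := fun _ z => z.2 * 2) Computable.id (Computable.const 1)
      (computable_nat_mul (Computable.snd.comp Computable.snd) (Computable.const 2))
  refine h.of_eq fun n => ?_
  induction n with
  | zero => rfl
  | succ n ih => rw [pow_succ, ← ih]

theorem computableRat_const (c : ℚ) : ComputableRat fun _ : β => c := by
  refine ⟨fun _ => c.num.toNat, fun _ => (-c.num).toNat, fun _ => c.den - 1,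
    Computable.const _, Computable.const _, Computable.const _, fun _ => ?_⟩
  have h1 : ((c.num.toNat : ℚ) - ((-c.num).toNat : ℚ)) = c.num := by
    exact_mod_cast Int.toNat_sub_toNat_neg c.num
  have h2 : ((c.den - 1 : ℕ) : ℚ) + 1 = c.den := by
    exact_mod_cast Nat.sub_add_cancel c.den_pos
  rw [h1, h2, Rat.num_div_den]

theorem ComputableRat.add {f g : β → ℚ} (hf : ComputableRat f) (hg : ComputableRat g) :
    ComputableRat fun x => f x + g x := by
  obtain ⟨p, q, d, hp, hq, hd, h⟩ := hf
  obtain ⟨p', q', d', hp', hq', hd', h'⟩ := hg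
  -- Denominators are stored minus one: `d * d' + (d + d') + 1 = (d + 1) * (d' + 1)`.
  refine ⟨fun x => p x * (d' x + 1) + p' x * (d x + 1),
    fun x => q x * (d' x + 1) + q' x * (d x + 1), fun x => d x * d' x + (d x + d' x),
    ?_, ?_, ?_, fun x => ?_⟩
  · exact computable_nat_add (computable_nat_mul hp (computable_nat_add hd' (.const 1)))
      (computable_nat_mul hp' (computable_nat_add hd (.const 1)))
  · exact computable_nat_add (computable_nat_mul hq (computable_nat_add hd' (.const 1)))
      (computable_nat_mul hq' (computable_nat_add hd (.const 1)))
  · exact computable_nat_add (computable_nat_mul hd hd') (computable_nat_add hd hd')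
  · have h1 : (d x : ℚ) + 1 ≠ 0 := by positivity
    have h2 : (d' x : ℚ) + 1 ≠ 0 := by positivity
    have h3 : (((d x * d' x + (d x + d' x) : ℕ) : ℚ) + 1) = (d x + 1) * (d' x + 1) := by
      push_cast; ring
    beta_reduce
    rw [h3, h, h', div_add_div _ _ h1 h2]
    push_cast
    congr 1
    ring

theorem ComputableRat.neg {f : β → ℚ} (hf : ComputableRat f) : ComputableRat fun x => -f x := by
  obtain ⟨p, q, d, hp, hq, hd, h⟩ := hf
  exact ⟨q, p, d, hq, hp, hd, fun x => by beta_reduce; rw [h, ← neg_div, neg_sub]⟩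

theorem ComputableRat.sub {f g : β → ℚ} (hf : ComputableRat f) (hg : ComputableRat g) :
    ComputableRat fun x => f x - g x := by
  simpa only [sub_eq_add_neg] using hf.add hg.neg

theorem ComputableRat.mul {f g : β → ℚ} (hf : ComputableRat f) (hg : ComputableRat g) :
    ComputableRat fun x => f x * g x := by
  obtain ⟨p, q, d, hp, hq, hd, h⟩ := hf
  obtain ⟨p', q', d', hp', hq', hd', h'⟩ := hg
  refine ⟨fun x => p x * p' x + q x * q' x, fun x => p x * q' x + q x * p' x,
    fun x => d x * d' x + (d x + d' x), ?_, ?_, ?_, fun x => ?_⟩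
  · exact computable_nat_add (computable_nat_mul hp hp') (computable_nat_mul hq hq')
  · exact computable_nat_add (computable_nat_mul hp hq') (computable_nat_mul hq hp')
  · exact computable_nat_add (computable_nat_mul hd hd') (computable_nat_add hd hd')
  · have h3 : (((d x * d' x + (d x + d' x) : ℕ) : ℚ) + 1) = (d x + 1) * (d' x + 1) := by
      push_cast; ring
    beta_reduce
    rw [h3, h, h', div_mul_div_comm]
    push_cast
    congr 1
    ring

theorem ComputableRat.max_zero {f : β → ℚ} (hf : ComputableRat f) :
    ComputableRat fun x => max (f x) 0 := by
  obtain ⟨p, q, d, hp, hq, hd, h⟩ := hf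
  -- Truncated subtraction of naturals performs the cut-off at zero.
  refine ⟨fun x => p x - q x, fun _ => 0, d, computable_nat_sub hp hq, .const 0, hd,
    fun x => ?_⟩
  have hd0 : (0 : ℚ) < (d x : ℚ) + 1 := by positivity
  beta_reduce
  rw [h]
  rcases le_total (q x) (p x) with hle | hle
  · have : (q x : ℚ) ≤ p x := by exact_mod_cast hle
    rw [max_eq_left (div_nonneg (sub_nonneg.2 this) hd0.le), Nat.cast_sub hle]
    simp
  · have : (p x : ℚ) ≤ q x := by exact_mod_cast hle
    rw [max_eq_right (div_nonpos_of_nonpos_of_nonneg (sub_nonpos.2 this) hd0.le),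
      Nat.sub_eq_zero_of_le hle]
    simp

theorem computableRat_inv_two_pow : ComputableRat fun n : ℕ => (2⁻¹ : ℚ) ^ n := by
  refine ⟨fun _ => 1, fun _ => 0, fun n => 2 ^ n - 1, .const 1, .const 0,
    computable_nat_sub computable_two_pow (.const 1), fun n => ?_⟩
  have h : ((2 ^ n - 1 : ℕ) : ℚ) + 1 = 2 ^ n := by
    exact_mod_cast Nat.sub_add_cancel (Nat.one_le_two_pow (n := n))
  rw [h]
  simp

theorem ComputableRat.sum_range {f : β × ℕ → ℚ} (hf : ComputableRat f) {k : β → ℕ}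
    (hk : Computable k) : ComputableRat fun x => ∑ i ∈ Finset.range (k x), f (x, i) := by
  obtain ⟨p, q, d, hp, hq, hd, h⟩ := hf
  -- The accumulator `(P, Q, D)` stands for the partial sum `(P - Q) / (D + 1)`.
  let step : β → ℕ × (ℕ × ℕ × ℕ) → ℕ × ℕ × ℕ := fun x z =>
    (z.2.1 * (d (x, z.1) + 1) + p (x, z.1) * (z.2.2.2 + 1),
      z.2.2.1 * (d (x, z.1) + 1) + q (x, z.1) * (z.2.2.2 + 1),
      z.2.2.2 * d (x, z.1) + (z.2.2.2 + d (x, z.1)))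
  let S : β → ℕ → ℕ × ℕ × ℕ := fun x m =>
    Nat.rec (motive := fun _ => ℕ × ℕ × ℕ) (0, 0, 0) (fun i z => step x (i, z)) m
  have hstep : Computable₂ step := by
    have hx : Computable fun w : β × (ℕ × (ℕ × ℕ × ℕ)) => (w.1, w.2.1) :=
      Computable.fst.pair (Computable.fst.comp Computable.snd)
    have hz : Computable fun w : β × (ℕ × (ℕ × ℕ × ℕ)) => w.2.2 :=
      Computable.snd.comp Computable.snd
    have hP := Computable.fst.comp hz
    have hQ := Computable.fst.comp (Computable.snd.comp hz)
    have hD := Computable.snd.comp (Computable.snd.comp hz)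
    have hdx := hd.comp hx
    have hd1 := computable_nat_add hdx (.const 1)
    have hD1 := computable_nat_add hD (.const 1)
    exact (computable_nat_add (computable_nat_mul hP hd1)
      (computable_nat_mul (hp.comp hx) hD1)).pair
      ((computable_nat_add (computable_nat_mul hQ hd1)
        (computable_nat_mul (hq.comp hx) hD1)).pair
        (computable_nat_add (computable_nat_mul hD hdx) (computable_nat_add hD hdx)))
  have hS : Computable fun x => S x (k x) := Computable.nat_rec hk (.const (0, 0, 0)) hstep
  refine ⟨fun x => (S x (k x)).1, fun x => (S x (k x)).2.1, fun x => (S x (k x)).2.2,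
    Computable.fst.comp hS, Computable.fst.comp (Computable.snd.comp hS),
    Computable.snd.comp (Computable.snd.comp hS), fun x => ?_⟩
  beta_reduce
  induction k x with
  | zero => simp [S]
  | succ m ih =>
    have hm : S x (m + 1) = step x (m, S x m) := rfl
    rw [Finset.sum_range_succ, ih, h, hm]
    have h1 : (d (x, m) : ℚ) + 1 ≠ 0 := by positivity
    have h2 : ((S x m).2.2 : ℚ) + 1 ≠ 0 := by positivity
    have h3 : ((step x (m, S x m)).2.2 : ℚ) + 1 = ((S x m).2.2 + 1) * (d (x, m) + 1) := by
      simp only [step]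
      push_cast
      ring
    rw [h3, div_add_div _ _ h2 h1]
    congr 1
    simp only [step]
    push_cast
    ring

end ComputableRat

/-! ### Randomness and the queueing bound. -/

theorem IsMartinLofRandom.ne_ratCast {α : ℝ} (hα : IsMartinLofRandom α) (x : ℚ) :
    (x : ℝ) ≠ α := by
  rintro rfl
  have hw : ComputableRat fun z : ℕ × ℕ => (2⁻¹ : ℚ) ^ (z.1 + 1) :=
    computableRat_inv_two_pow.comp (computable_nat_add Computable.fst (.const 1))
  -- Radius `2⁻¹ ^ (n + 1)` gives length exactly `2⁻¹ ^ n`.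
  obtain ⟨n, hn⟩ := hα (fun z => x - 2⁻¹ ^ (z.1 + 1)) (fun z => x + 2⁻¹ ^ (z.1 + 1))
    ⟨(computableRat_const x).sub hw, (computableRat_const x).add hw, fun n => by
      dsimp only [openSection]
      rw [Set.iUnion_const, Real.volume_Ioo]
      refine le_of_eq ?_
      have : (((x + 2⁻¹ ^ (n + 1) : ℚ) : ℝ) - ((x - 2⁻¹ ^ (n + 1) : ℚ) : ℝ)) = 2⁻¹ ^ n := by
        push_cast
        ring
      rw [this, ENNReal.ofReal_pow (by norm_num), ENNReal.ofReal_inv_of_pos (by norm_num)]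
      simp⟩
  refine hn (Set.mem_iUnion.2 ⟨0, ?_⟩)
  have h0 : (0 : ℝ) < 2⁻¹ ^ (n + 1) := by positivity
  constructor <;> push_cast <;> linarith

/-- `queueEnd a b δ t` is `a t` plus the workload at time `t` of an initially empty queue that
receives the increments of `δ * b` and is served by the increments of `a`; equivalently, it is the
maximum of `a s + δ * (b t - b s)` over `s ≤ t`. -/
noncomputable def queueEnd (a b : ℕ → ℝ) (δ : ℝ) : ℕ → ℝ
  | 0 => a 0
  | t + 1 => max (queueEnd a b δ t + δ * (b (t + 1) - b t)) (a (t + 1))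

theorem add_mul_sub_le_queueEnd (a b : ℕ → ℝ) (δ : ℝ) (s j : ℕ) :
    a s + δ * (b (s + j) - b s) ≤ queueEnd a b δ (s + j) := by
  induction j with
  | zero => cases s <;> simp [queueEnd]
  | succ j ih =>
    refine le_trans ?_ (le_max_left _ _)
    change a s + δ * (b (s + j + 1) - b s) ≤
      queueEnd a b δ (s + j) + δ * (b (s + j + 1) - b (s + j))
    linarith

/-- Pending work at time `t` was appended at the end of the queue at some earlier step, and the
appended blocks never move; service only removes points on the left. -/
theorem Ioo_queueEnd_subset {a b : ℕ → ℝ} (ha : Monotone a) (δ : ℝ) (t : ℕ) :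
    Set.Ioo (a t) (queueEnd a b δ t) ⊆
      ⋃ u, Set.Ico (queueEnd a b δ u) (queueEnd a b δ u + δ * (b (u + 1) - b u)) := by
  induction t with
  | zero => simp [queueEnd]
  | succ t ih =>
    rintro x ⟨hx1, hx2⟩
    have hx3 : x < queueEnd a b δ t + δ * (b (t + 1) - b t) :=
      (lt_max_iff.1 hx2).resolve_right hx1.not_gt
    rcases le_or_gt (queueEnd a b δ t) x with h | h
    · exact Set.mem_iUnion.2 ⟨t, h, hx3⟩
    · exact ih ⟨(ha t.le_succ).trans_lt hx1, h⟩

/-- Every interval lies in the queue at time `s + j`, hence in the appended blocks, whose lengths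
telescope to at most `δ`. -/
theorem volume_iUnion_Ioo_le {a b : ℕ → ℝ} (ha : Monotone a) (hb : Monotone b)
    (hb0 : 0 ≤ b 0) (hb1 : ∀ t, b t ≤ 1) {δ : ℝ} (hδ : 0 ≤ δ) :
    volume (⋃ k : ℕ, Set.Ioo (a (k.unpair.1 + k.unpair.2))
      (a k.unpair.1 + δ * (b (k.unpair.1 + k.unpair.2) - b k.unpair.1))) ≤ ENNReal.ofReal δ := by
  have hsub : (⋃ k : ℕ, Set.Ioo (a (k.unpair.1 + k.unpair.2))
      (a k.unpair.1 + δ * (b (k.unpair.1 + k.unpair.2) - b k.unpair.1))) ⊆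
      ⋃ u, Set.Ico (queueEnd a b δ u) (queueEnd a b δ u + δ * (b (u + 1) - b u)) :=
    Set.iUnion_subset fun k =>
      (Set.Ioo_subset_Ioo_right (add_mul_sub_le_queueEnd a b δ _ _)).trans
        (Ioo_queueEnd_subset ha δ _)
  refine (measure_mono hsub).trans ((measure_iUnion_le _).trans ?_)
  refine ENNReal.tsum_le_of_sum_range_le fun n => ?_
  simp only [Real.volume_Ico, add_sub_cancel_left]
  rw [← ENNReal.ofReal_sum_of_nonneg
    fun i _ => mul_nonneg hδ (sub_nonneg.2 (hb i.le_succ)), ← Finset.mul_sum,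
    Finset.sum_range_sub]
  exact ENNReal.ofReal_le_ofReal (mul_le_of_le_one_right hδ (by linarith [hb1 n]))

/-- No computable bounded nondecreasing sequence converges more slowly, up to a constant factor,
than a computable nondecreasing sequence with a Martin-Löf random limit. -/
theorem IsMartinLofRandom.exists_mul_sub_le {a b : ℕ → ℚ} {α : ℝ} (hα : IsMartinLofRandom α)
    (ha : ComputableRat a) (hmono : Monotone a)
    (hlim : Tendsto (fun i => (a i : ℝ)) atTop (𝓝 α)) (hb : ComputableRat b)
    (hbmono : Monotone b) (hb0 : 0 ≤ b 0) (hb1 : ∀ t, b t ≤ 1) :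
    ∃ n : ℕ, ∀ s t, s ≤ t → (b t : ℝ) - b s ≤ 2 ^ n * (α - a s) := by
  have hs : Computable fun z : ℕ × ℕ => z.2.unpair.1 :=
    Computable.fst.comp (Computable.unpair.comp Computable.snd)
  have hj : Computable fun z : ℕ × ℕ => z.2.unpair.2 :=
    Computable.snd.comp (Computable.unpair.comp Computable.snd)
  have ht := computable_nat_add hs hj
  obtain ⟨n, hn⟩ := hα (fun z => a (z.2.unpair.1 + z.2.unpair.2))
    (fun z => a z.2.unpair.1 +
      2⁻¹ ^ z.1 * (b (z.2.unpair.1 + z.2.unpair.2) - b z.2.unpair.1))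
    ⟨ha.comp ht, (ha.comp hs).add
      ((computableRat_inv_two_pow.comp Computable.fst).mul ((hb.comp ht).sub (hb.comp hs))),
      fun n => by
        have h := volume_iUnion_Ioo_le (a := fun i => (a i : ℝ)) (b := fun i => (b i : ℝ))
          (Rat.cast_mono.comp hmono)
          (Rat.cast_mono.comp hbmono)
          (by exact_mod_cast hb0) (fun t => by exact_mod_cast hb1 t)
          (δ := 2⁻¹ ^ n) (by positivity)
        rw [ENNReal.ofReal_pow (by norm_num), ENNReal.ofReal_inv_of_pos (by norm_num)] at h
        rw [openSection]
        push_cast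
        simpa using h⟩
  refine ⟨n, fun s t hst => ?_⟩
  obtain ⟨j, rfl⟩ := Nat.exists_eq_add_of_le hst
  -- The test intervals are open, so strictness is needed; it holds because `α` is irrational.
  have hlt : (a (s + j) : ℝ) < α := by
    refine lt_of_le_of_ne ?_ (hα.ne_ratCast _)
    exact Monotone.ge_of_tendsto (f := fun i => (a i : ℝ))
      (Rat.cast_mono.comp hmono) hlim _
  have hle : (a s : ℝ) + 2⁻¹ ^ n * (b (s + j) - b s) ≤ α := by
    by_contra! hcon
    refine hn (Set.mem_iUnion.2 ⟨Nat.pair s j, ?_⟩)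
    simp only [Nat.unpair_pair]
    refine ⟨hlt, ?_⟩
    push_cast
    exact hcon
  have h2 : (2 : ℝ) ^ n * 2⁻¹ ^ n = 1 := by rw [← mul_pow]; norm_num
  calc (b (s + j) : ℝ) - b s = 2 ^ n * (2⁻¹ ^ n * (b (s + j) - b s)) := by
        rw [← mul_assoc, h2, one_mul]
    _ ≤ 2 ^ n * (α - a s) := by gcongr; linarith

/-! ### Approximating the mass of a semimeasure. -/

/-- The total mass of a lower semicomputable semimeasure is approximated from below by a computable
sequence of rationals whose error at step `N` bounds the mass of all numbers not below `N`. -/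
theorem IsLSCSemimeasure.exists_approx {μ : ℕ → ℝ} (hμ : IsLSCSemimeasure μ) :
    ∃ b : ℕ → ℚ, ComputableRat b ∧ Monotone b ∧ 0 ≤ b 0 ∧ (∀ t, b t ≤ 1) ∧
      ∀ (N : ℕ) (B : ℝ), (∀ t, N + 1 ≤ t → (b t : ℝ) - b (N + 1) ≤ B) →
        ∑' n : Set.Ioi N, μ n ≤ B := by
  obtain ⟨q, hq, hqμ⟩ := hμ.lowerSemicomputable
  let r : ℕ × ℕ → ℚ := fun z => max (q z) 0
  have hr0 : ∀ z, 0 ≤ r z := fun z => le_max_right _ _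
  have hrmono : ∀ i, Monotone fun s => r (i, s) := fun i s t hst =>
    max_le_max_right _ ((hqμ i).1 hst)
  have hrlim : ∀ i, Tendsto (fun s => (r (i, s) : ℝ)) atTop (𝓝 (μ i)) := fun i => by
    have h := (hqμ i).2.max (tendsto_const_nhds (x := (0 : ℝ)))
    rw [max_eq_left (hμ.nonneg i)] at h
    simpa [r] using h
  have hrle : ∀ i s, (r (i, s) : ℝ) ≤ μ i := fun i s =>
    Monotone.ge_of_tendsto (f := fun s => (r (i, s) : ℝ))
      (Rat.cast_mono.comp (hrmono i)) (hrlim i) s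
  have hb : Monotone fun t => ∑ i ∈ Finset.range t, r (i, t) := fun s t hst =>
    (Finset.sum_le_sum fun i _ => hrmono i hst).trans
      (Finset.sum_le_sum_of_subset_of_nonneg (Finset.range_mono hst) fun i _ _ => hr0 _)
  refine ⟨fun t => ∑ i ∈ Finset.range t, r (i, t), ?_, hb, by simp, fun t => ?_, ?_⟩
  · exact (hq.max_zero.comp (Computable.snd.pair Computable.fst)).sum_range Computable.id
  · have h : (∑ i ∈ Finset.range t, (r (i, t) : ℝ)) ≤ 1 :=
      (Finset.sum_le_sum fun i _ => hrle i t).trans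
        ((hμ.summable.sum_le_tsum _ fun i _ => hμ.nonneg i).trans hμ.tsum_le_one)
    exact_mod_cast h
  · intro N B hB
    refine Real.tsum_le_of_sum_le (fun n => hμ.nonneg n) fun F => ?_
    let G : Finset ℕ := F.map (Function.Embedding.subtype _)
    have hG : ∀ i ∈ G, N < i := fun i hi => by
      obtain ⟨x, -, rfl⟩ := Finset.mem_map.1 hi
      exact x.2
    have hFG : ∑ n ∈ F, μ n = ∑ i ∈ G, μ i := by simp [G]
    rw [hFG]
    refine le_of_tendsto (tendsto_finsetSum G fun i _ => hrlim i) ?_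
    -- Once `t` exceeds all of `G`, `b t` contains the terms over `G` besides those with `i ≤ N`,
    -- which are at least their values in `b (N + 1)`.
    filter_upwards [eventually_ge_atTop (N + 1), eventually_gt_atTop (G.sup id)] with t ht htG
    refine le_trans ?_ (hB t ht)
    have hdisj : Disjoint (Finset.range (N + 1)) G :=
      Finset.disjoint_left.2 fun i hi hiG => by
        have := hG i hiG
        have := Finset.mem_range.1 hi
        omega
    have hsub : Finset.range (N + 1) ∪ G ⊆ Finset.range t := by
      refine Finset.union_subset (Finset.range_mono ht) fun i hi => Finset.mem_range.2 ?_
      exact (Finset.le_sup (f := id) hi).trans_lt htG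
    have h1 : ∑ i ∈ Finset.range (N + 1), r (i, N + 1) + ∑ i ∈ G, r (i, t) ≤
        ∑ i ∈ Finset.range t, r (i, t) := by
      refine le_trans ?_ (Finset.sum_le_sum_of_subset_of_nonneg hsub fun i _ _ => hr0 _)
      rw [Finset.sum_union hdisj]
      gcongr with i
      exact hrmono i ht
    rw [le_sub_iff_add_le, add_comm]
    exact_mod_cast h1

end CompetingBeavers

theorem mainTheorem12 (μ : ℕ → ℝ) (hμ : CompetingBeavers.IsUniversalSemimeasure μ)
    (a : ℕ → ℚ) (ha : CompetingBeavers.ComputableRat a) (hmono : Monotone a)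
    (α : ℝ) (hlim : Filter.Tendsto (fun i => (a i : ℝ)) Filter.atTop (nhds α))
    (hα : CompetingBeavers.IsMartinLofRandom α) :
    ∃ c : ℕ, ∀ m : ℕ,
      CompetingBeavers.BP' μ ((m : ℤ) - (c : ℤ)) ≤
        CompetingBeavers.modulus a α ((2 : ℝ) ^ (-(m : ℤ))) := by
  obtain ⟨b, hb, hbmono, hb0, hb1, htail⟩ := hμ.toIsLSCSemimeasure.exists_approx
  obtain ⟨c, hc⟩ := hα.exists_mul_sub_le ha hmono hlim hb hbmono hb0 hb1
  refine ⟨c, fun m => Nat.sInf_le ?_⟩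
  -- The first index past the modulus, `N + 1`, is also where `b` has summed exactly the terms `i ≤
  -- N`.
  have hN := CompetingBeavers.modulus_spec hlim (by positivity : (0 : ℝ) < 2 ^ (-(m : ℤ))) _
    (Nat.lt_succ_self _)
  refine (htail _ _ fun t ht => hc _ t ht).trans_lt ?_
  rw [neg_sub, sub_eq_add_neg (c : ℤ), zpow_add₀ two_ne_zero, zpow_natCast]
  gcongr
  exact (le_abs_self _).trans_lt hN
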